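/- Let $m\ge 1$ and $n=2^m$. Let $\mathrm{RM}(m,1)\subseteq\{0,1\}^n$ be the binary first-order Reed-Muller code, that is, the set of evaluation vectors $(f(z))_{z\in\mathbb F_2^m}$ (points in lexicographic order) of the polynomials $f=u_0+u_1\mathsf x_1+\dots+u_m\mathsf x_m$ with $u_0,\dots,u_m\in\mathbb F_2$. A trace of $x\in\{0,1\}^n$ is the random subsequence obtained by deleting each bit of $x$ independently with probability $1/2$. The number of runs of a sequence is the number of its maximal blocks of equal consecutive symbols, and $\mathbb E[R_x]$ denotes the expected number of runs in a trace of $x$. For every $c\in\mathbb N$ the following holds. (i) There is a constant $C>0$, depending only on $c$, such that for every $m\ge1$ there are a number $k\le C\,n^2\log n$ and a reconstruction map (a function of $k$ binary sequences) which, for every $x\in\mathrm{RM}(m,1)$, returns $x$ with probability at least $1-n^{-c}$ when it is applied to $k$ independent traces of $x$. (ii) There are constants $c_1,c_2>0$, depending only on $c$, such that for every $m\ge2$, with $\ell=\lceil c_1\log n\rceil$ and $k=\lceil c_2n^2\log n\rceil$, one has $\ell<k$, and for every $x\in\mathrm{RM}(m,1)$ the following algorithm, applied to $k$ independent traces of $x$,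 outputs $x$ with probability at least $1-n^{-c}$, whatever rule it uses to break ties. Step 1: if more than $\ell/2$ of the first $\ell$ traces start with a $1$, set $b=1$; otherwise set $b=0$. Step 2: let $\overline R$ be the average of the numbers of runs in the $k$ traces; output a $z\in\mathrm{RM}(m,1)$ with first bit $b$ that minimizes $|\mathbb E[R_z]-\overline R|$ among all such codewords. (An empty trace has no runs and does not start with a $1$.) -/

import Mathlib

open MeasureTheory ProbabilityTheory
open scoped unitInterval

noncomputable section

namespace TraceRM

/-- The `j`-th point of `𝔽₂^m` in the lexicographic order (`j = 0, …, 2^m - 1`): the binary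
expansion of `j`, most significant bit first. -/
def lexPoint (m : ℕ) (j : Fin (2 ^ m)) (i : Fin m) : ZMod 2 :=
  if (j : ℕ).testBit (m - 1 - i) then 1 else 0

/-- The affine polynomial `u₀ + u₁ x₁ + ⋯ + u_m x_m` over `𝔽₂`. -/
def affinePoly (m : ℕ) (u₀ : ZMod 2) (u : Fin m → ZMod 2) : MvPolynomial (Fin m) (ZMod 2) :=
  MvPolynomial.C u₀ + ∑ i, MvPolynomial.C (u i) * MvPolynomial.X i

/-- The evaluation vector of a polynomial at all points of `𝔽₂^m`, in lexicographic order. -/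
def evalVec (m : ℕ) (f : MvPolynomial (Fin m) (ZMod 2)) : Fin (2 ^ m) → ZMod 2 :=
  fun j => MvPolynomial.eval (lexPoint m j) f

/-- The binary first-order Reed-Muller code `RM(m,1)`, of blocklength `2^m`. -/
def RM1 (m : ℕ) : Set (Fin (2 ^ m) → ZMod 2) :=
  {x | ∃ (u₀ : ZMod 2) (u : Fin m → ZMod 2), x = evalVec m (affinePoly m u₀ u)}

/-- The trace of `x` under the deletion pattern `ω`: the bit `x j` is deleted iff `ω j = true`,
and the remaining bits are kept in their order. -/
def trace {n : ℕ} (x : Fin n → ZMod 2) (ω : Fin n → Bool) : List (ZMod 2) :=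
  ((List.finRange n).filter (fun j => !ω j)).map x

/-- The law of the deletion pattern: each of the `n` positions is deleted independently
with probability `q`. -/
def deletionMeasure (q : I) (n : ℕ) : Measure (Fin n → Bool) :=
  Measure.pi fun _ => bernoulliMeasure true false q

/-- The joint law of the deletion patterns of `k` independent traces. -/
def tracesMeasure (q : I) (n k : ℕ) : Measure (Fin k → Fin n → Bool) :=
  Measure.pi fun _ => deletionMeasure q n

/-- The number of runs (maximal blocks of equal consecutive symbols) in a binary sequence. -/
def numRuns : List (ZMod 2) → ℕ
  | [] => 0
  | [_] => 1
  | a :: b :: l => (if a = b then 0 else 1) + numRuns (b :: l)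

/-- `𝔼[R_x]`: the expected number of runs in a trace of `x`. -/
def expectedRuns (q : I) {n : ℕ} (x : Fin n → ZMod 2) : ℝ :=
  ∫ ω, (numRuns (trace x ω) : ℝ) ∂deletionMeasure q n

/-- The deletion probability `1/2`. -/
def half : I := ⟨1 / 2, by norm_num, by norm_num⟩

/-- Majority vote on the first bit of the first `ℓ` traces: the result is `1` if more than
`ℓ / 2` of these traces start with a `1`, and `0` otherwise. -/
def majorityBit {k : ℕ} (ℓ : ℕ) (T : Fin k → List (ZMod 2)) : ZMod 2 :=
  if (ℓ : ℝ) / 2 <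
      ((Finset.univ.filter fun i : Fin k => (i : ℕ) < ℓ ∧ (T i).head? = some 1).card : ℝ)
  then 1 else 0

/-- The empirical average of the number of runs in the `k` traces. -/
def averageRuns {k : ℕ} (T : Fin k → List (ZMod 2)) : ℝ :=
  (1 / (k : ℝ)) * ∑ i, (numRuns (T i) : ℝ)

/-- The codewords the algorithm may choose from: those of `RM(m,1)` whose first bit is the
result of the majority vote. -/
def candidates (m : ℕ) {k : ℕ} (ℓ : ℕ) (T : Fin k → List (ZMod 2)) :
    Set (Fin (2 ^ m) → ZMod 2) :=
  {z | z ∈ RM1 m ∧ z ⟨0, Nat.two_pow_pos m⟩ = majorityBit ℓ T}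

/-- `z` is a possible output of the reconstruction algorithm on the traces `T`: among the
candidates, it minimizes the distance of the expected number of runs (for deletion
probability `1/2`) to the empirical average. -/
def IsOutput (m : ℕ) {k : ℕ} (ℓ : ℕ) (T : Fin k → List (ZMod 2))
    (z : Fin (2 ^ m) → ZMod 2) : Prop :=
  z ∈ candidates m ℓ T ∧
    ∀ y ∈ candidates m ℓ T,
      |expectedRuns half z - averageRuns T| ≤ |expectedRuns half y - averageRuns T|

end TraceRM

end

noncomputable section

namespace TraceRM

/-! Write codewords with signs. Positions i < j are adjacent in a trace with probability
2^{-(j-i+1)}, so the expected number of runs is a constant depending on n minus a quarter of the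
autocorrelation ∑_{i<j} x_i x_j 2^{-(j-i)} (`expectedRuns_half`). A codeword of `RM1 m` is, up to a
global sign fixed by its first bit, a Walsh character. The autocorrelation ignores that sign, so the
bit needs a separate vote.

A Walsh character is built by repeated doubling, and doubling turns the autocorrelation at r into an
affine function of the one at r². Iterating, distinct Walsh characters of length 2^K have
autocorrelations at 1/2 at least 1/16 apart, independently of K (`walshCorr_gap`,
`autocorr_walsh_gap`). Hence codewords with equal first bit have expected run counts at least 1/64
apart (`expectedRuns_gap`).

For m ≥ 2 the first symbol of a trace is biased towards the first bit by a constant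
(`integral_head_codeword`). Hoeffding's inequality then makes the vote right with order log n
traces, and the average of run counts in [0, n] accurate to a constant with order n² log n traces.
The true codeword is then the unique minimizer (`isOutput_iff`). For m = 1 the vote may be unbiased,
and part (i) waits for an undeleted trace instead. -/

/-! ### Autocorrelations of Walsh characters under doubling -/

/-- The generating sum `∑_{j < N} x j r ^ j`. -/
def geomSum (r : ℝ) : ℕ → (ℕ → ℝ) → ℝ
  | 0, _ => 0
  | N + 1, x => x 0 + r * geomSum r N (fun j => x (j + 1))

/-- The weighted autocorrelation `∑_{i < j < N} x i x j r ^ (j - i)`. -/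
def autocorr (r : ℝ) : ℕ → (ℕ → ℝ) → ℝ
  | 0, _ => 0
  | N + 1, x => autocorr r N (fun j => x (j + 1)) + r * x 0 * geomSum r N (fun j => x (j + 1))

/-- Replace each entry `a` of a sequence by the two entries `a`, `s * a`. -/
def double (s : ℝ) (x : ℕ → ℝ) (j : ℕ) : ℝ := (if j.testBit 0 then s else 1) * x (j / 2)

/-- The Walsh character with signs `s` on the `K` lowest binary digits. -/
def walsh (K : ℕ) (s : ℕ → ℝ) (j : ℕ) : ℝ := ∏ b ∈ Finset.range K, if j.testBit b then s b else 1

/-- The normalized autocorrelation of a Walsh character, see `two_mul_autocorr_walsh`. -/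
def walshCorr : ℕ → (ℕ → ℝ) → ℝ → ℝ
  | 0, _, _ => 0
  | K + 1, s, a => s 0 + s 0 * (1 + s 0 * a) ^ 2 * walshCorr K (fun b => s (b + 1)) (a ^ 2) / 2

/-- The maximal value of `walshCorr` over all signs. -/
def walshCorrMax (K : ℕ) (a : ℝ) : ℝ :=
  (2 * (1 - a) - 2 / 2 ^ K * (1 - a ^ 2 ^ K)) / (1 - a) ^ 2

lemma geomSum_smul (r c : ℝ) (N : ℕ) (x : ℕ → ℝ) :
    geomSum r N (fun j => c * x j) = c * geomSum r N x := by
  induction N generalizing x with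
  | zero => simp [geomSum]
  | succ N ih => simp only [geomSum, ih fun j => x (j + 1)]; ring

lemma autocorr_smul (r c : ℝ) (hc : c ^ 2 = 1) (N : ℕ) (x : ℕ → ℝ) :
    autocorr r N (fun j => c * x j) = autocorr r N x := by
  induction N generalizing x with
  | zero => simp [autocorr]
  | succ N ih =>
    simp only [autocorr, ih fun j => x (j + 1), geomSum_smul r c N fun j => x (j + 1)]
    linear_combination r * x 0 * geomSum r N (fun j => x (j + 1)) * hc

lemma double_zero (s : ℝ) (x : ℕ → ℝ) : double s x 0 = x 0 := by simp [double]

lemma double_one (s : ℝ) (x : ℕ → ℝ) : double s x 1 = s * x 0 := by simp [double]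

lemma double_add_two (s : ℝ) (x : ℕ → ℝ) :
    (fun j => double s x (j + 1 + 1)) = double s fun j => x (j + 1) := by
  funext j
  have h : (j + 1 + 1) / 2 = j / 2 + 1 := by omega
  have h2 : (j + 1 + 1) % 2 = j % 2 := by omega
  simp [double, Nat.testBit_zero, h, h2]

lemma geomSum_double (r s : ℝ) (N : ℕ) (x : ℕ → ℝ) :
    geomSum r (2 * N) (double s x) = (1 + s * r) * geomSum (r ^ 2) N x := by
  induction N generalizing x with
  | zero => simp [geomSum]
  | succ N ih =>
    rw [show 2 * (N + 1) = 2 * N + 1 + 1 by ring]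
    simp only [geomSum, zero_add, double_zero, double_one, double_add_two, ih]
    ring

/-- Each doubled pair contributes s r. Two pairs at distance d contribute s r^{2d-1} + 2 r^{2d} + s
r^{2d+1} = s (1 + s r)² r^{2d-1}, because s² = 1. -/
lemma autocorr_double {r s : ℝ} (hr : r ≠ 0) (hs : s ^ 2 = 1) (N : ℕ) (x : ℕ → ℝ)
    (hx : ∀ j, x j ^ 2 = 1) :
    autocorr r (2 * N) (double s x) =
      N * s * r + s * (1 + s * r) ^ 2 / r * autocorr (r ^ 2) N x := by
  induction N generalizing x with
  | zero => simp [autocorr]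
  | succ N ih =>
    rw [show 2 * (N + 1) = 2 * N + 1 + 1 by ring]
    simp only [autocorr, geomSum, zero_add, double_zero, double_one, double_add_two,
      ih _ fun j => hx (j + 1), geomSum_double]
    have h0 := hx 0
    field_simp
    push_cast
    linear_combination (r ^ 2 * s) * h0 +
      (-(r ^ 2 * x 0 * geomSum (r ^ 2) N (fun j => x (j + 1)) * (r + r ^ 2 * s))) * hs

lemma walsh_succ (K : ℕ) (s : ℕ → ℝ) :
    walsh (K + 1) s = double (s 0) (walsh K fun b => s (b + 1)) := by
  funext j
  simp only [walsh, double, Finset.prod_range_succ', Nat.testBit_succ]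
  ring

lemma sq_eq_one_of_sign {a : ℝ} (h : a = 1 ∨ a = -1) : a ^ 2 = 1 := by
  rcases h with rfl | rfl <;> norm_num

lemma walsh_sq {s : ℕ → ℝ} (hs : ∀ b, s b = 1 ∨ s b = -1) (K j : ℕ) : walsh K s j ^ 2 = 1 := by
  rw [walsh, ← Finset.prod_pow]
  refine Finset.prod_eq_one fun b _ => ?_
  split_ifs
  · exact sq_eq_one_of_sign (hs b)
  · norm_num

lemma two_mul_autocorr_walsh {r : ℝ} (hr : r ≠ 0) (K : ℕ) {s : ℕ → ℝ}
    (hs : ∀ b, s b = 1 ∨ s b = -1) :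
    2 * autocorr r (2 ^ K) (walsh K s) = 2 ^ K * r * walshCorr K s r := by
  induction K generalizing s r with
  | zero => simp [autocorr, geomSum, walshCorr]
  | succ K ih =>
    have h := ih (pow_ne_zero 2 hr) fun b => hs (b + 1)
    rw [walsh_succ, pow_succ', autocorr_double hr (sq_eq_one_of_sign (hs 0)) _ _
      (walsh_sq (fun b => hs (b + 1)) K), walshCorr]
    field_simp
    push_cast
    linear_combination 2 * s 0 * (1 + s 0 * r) ^ 2 * h

/-! ### Separation of Walsh characters -/

lemma walshCorrMax_succ (K : ℕ) {a : ℝ} (h1 : a ≠ 1) (h2 : a ≠ -1) :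
    walshCorrMax (K + 1) a = 1 + (1 + a) ^ 2 * walshCorrMax K (a ^ 2) / 2 := by
  have h1' : 1 - a ≠ 0 := sub_ne_zero.2 h1.symm
  have h2' : 1 + a ≠ 0 := fun h => h2 (by linarith)
  have h3 : (1 - a ^ 2) = (1 - a) * (1 + a) := by ring
  simp only [walshCorrMax, h3, ← pow_mul, ← pow_succ']
  field_simp
  ring

/-- The closed form leaves exactly 4/2^{K+1} · (1 - (-a²)^{2^K})/(1 + a²). The weaker factor (1 -
a)^4 is the one that survives the induction in `walshCorr_gap`. -/
lemma two_sub_walshCorrMax_neg_ge (K : ℕ) {a : ℝ} (h0 : 0 < a) (h1 : a < 1) :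
    4 / 2 ^ (K + 1) * (1 - a) ^ 4 ≤ 2 - (1 + a ^ 2) * walshCorrMax K (-a ^ 2) := by
  have hb : 0 < 1 + a ^ 2 := by positivity
  have e : 2 - (1 + a ^ 2) * walshCorrMax K (-a ^ 2) =
      4 / 2 ^ (K + 1) * ((1 - (-a ^ 2) ^ 2 ^ K) / (1 + a ^ 2)) := by
    simp only [walshCorrMax, sub_neg_eq_add]
    field_simp
    ring
  have hp : (-a ^ 2) ^ 2 ^ K ≤ a ^ 2 := by
    refine (le_abs_self _).trans ?_
    rw [abs_pow, abs_neg, abs_of_nonneg (sq_nonneg a)]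
    exact pow_le_of_le_one (sq_nonneg a) (by nlinarith) (by positivity)
  rw [e]
  refine mul_le_mul_of_nonneg_left ?_ (by positivity)
  rw [le_div_iff₀ hb]
  have h3 : (1 - a) ^ 3 * (1 + a ^ 2) ≤ 1 + a := by
    have := pow_le_one₀ (n := 2) (by linarith : 0 ≤ 1 - a) (by linarith)
    have h4 : (1 - a) * (1 + a ^ 2) ≤ 1 := by nlinarith
    have h5 : 0 ≤ (1 - a) * (1 + a ^ 2) := mul_nonneg (by linarith) hb.le
    nlinarith [sq_nonneg (1 - a)]
  nlinarith [mul_le_mul_of_nonneg_left h3 (by linarith : 0 ≤ 1 - a)]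

/-- The upper end obeys the recursion with all signs +1, the lower end the one with only `s 0` equal
to -1. The mixed cases close because the difference of the two branches is nonnegative by
`two_sub_walshCorrMax_neg_ge`. -/
lemma walshCorr_mem_Icc (K : ℕ) {s : ℕ → ℝ} (hs : ∀ b, s b = 1 ∨ s b = -1) {a : ℝ}
    (h0 : 0 < a) (h1 : a < 1) :
    walshCorr K s a ∈ Set.Icc (-walshCorrMax K (-a)) (walshCorrMax K a) := by
  induction K generalizing s a with
  | zero => simp [walshCorr, walshCorrMax]
  | succ K ih =>
    have ha : 0 < a ^ 2 := by positivity
    have ha1 : a ^ 2 < 1 := by nlinarith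
    obtain ⟨hl, hu⟩ := ih (fun b => hs (b + 1)) ha ha1
    have hgap := two_sub_walshCorrMax_neg_ge K h0 h1
    have hpos : 0 ≤ 4 / 2 ^ (K + 1) * (1 - a) ^ 4 := by positivity
    rw [walshCorrMax_succ K (by linarith) (by linarith),
      walshCorrMax_succ K (by linarith) (by linarith), walshCorr, neg_sq]
    set F := walshCorr K (fun b => s (b + 1)) (a ^ 2)
    have hp := sq_nonneg (1 + a)
    have hm := sq_nonneg (1 - a)
    rcases hs 0 with h | h <;> rw [h] <;> constructor <;> nlinarith

/-- Bounding both tails below by the same extremal value gives them total weight ((1 + a)² + (1 -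
a)²)/2 = 1 + a², which is the quantity in `two_sub_walshCorrMax_neg_ge`. -/
lemma walshCorr_gap_of_ne_zero (K : ℕ) {s t : ℕ → ℝ} (hs : ∀ b, s b = 1 ∨ s b = -1)
    (ht : ∀ b, t b = 1 ∨ t b = -1) {a : ℝ} (h0 : 0 < a) (h1 : a < 1)
    (hs0 : s 0 = 1) (ht0 : t 0 = -1) :
    4 / 2 ^ (K + 1) * (1 - a) ^ 4 ≤ walshCorr (K + 1) s a - walshCorr (K + 1) t a := by
  have ha : 0 < a ^ 2 := by positivity
  have ha1 : a ^ 2 < 1 := by nlinarith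
  obtain ⟨hl, -⟩ := walshCorr_mem_Icc K (fun b => hs (b + 1)) ha ha1
  obtain ⟨hl', -⟩ := walshCorr_mem_Icc K (fun b => ht (b + 1)) ha ha1
  refine (two_sub_walshCorrMax_neg_ge K h0 h1).trans ?_
  rw [walshCorr, walshCorr, hs0, ht0]
  have hp := sq_nonneg (1 + a)
  have hm := sq_nonneg (1 - a)
  nlinarith [mul_le_mul_of_nonneg_left hl hp, mul_le_mul_of_nonneg_left hl' hm]

/-- Equal lowest signs are peeled off, replacing a by a² and scaling the difference by at least (1 -
a)²/2, until the first disagreement. -/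
lemma walshCorr_gap (K : ℕ) {s t : ℕ → ℝ} (hs : ∀ b, s b = 1 ∨ s b = -1)
    (ht : ∀ b, t b = 1 ∨ t b = -1) {a : ℝ} (h0 : 0 < a) (h1 : a ≤ 1 / 2)
    (hne : ∃ b < K, s b ≠ t b) :
    4 / 2 ^ K * (1 - a) ^ 4 ≤ |walshCorr K s a - walshCorr K t a| := by
  induction K generalizing s t a with
  | zero => obtain ⟨b, hb, -⟩ := hne; omega
  | succ K ih =>
    by_cases h : s 0 = t 0
    · have hne' : ∃ b < K, s (b + 1) ≠ t (b + 1) := by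
        obtain ⟨_ | b, hb, hb'⟩ := hne
        · exact absurd h hb'
        · exact ⟨b, by omega, hb'⟩
      have ha1 : a ^ 2 ≤ 1 / 2 := by nlinarith
      have key := ih (fun b => hs (b + 1)) (fun b => ht (b + 1)) (by positivity : 0 < a ^ 2)
        ha1 hne'
      have hc : (1 - a) ^ 2 ≤ (1 + s 0 * a) ^ 2 := by
        rcases hs 0 with h | h <;> rw [h] <;> nlinarith
      have hs1 : |s 0| = 1 := by rcases hs 0 with h | h <;> simp [h]
      -- The bound reproduces itself under a ↦ a²; this is where a ≤ 1/2 enters, through a + a² ≤ 1.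
      have hg : (1 - a) ^ 4 ≤ (1 - a) ^ 2 * (1 - a ^ 2) ^ 4 := by
        have h2 : 1 ≤ (1 + a) * (1 - a ^ 2) := by nlinarith
        have h3 : 1 ≤ ((1 + a) * (1 - a ^ 2)) ^ 2 := one_le_pow₀ h2
        have e : (1 - a) ^ 2 * (1 - a ^ 2) ^ 4 = (1 - a) ^ 4 * ((1 + a) * (1 - a ^ 2)) ^ 2 := by
          ring
        rw [e]
        exact le_mul_of_one_le_right (by positivity) h3
      have e : walshCorr (K + 1) s a - walshCorr (K + 1) t a =
          s 0 * ((1 + s 0 * a) ^ 2 / 2 * (walshCorr K (fun b => s (b + 1)) (a ^ 2) -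
            walshCorr K (fun b => t (b + 1)) (a ^ 2))) := by
        simp only [walshCorr, ← h]; ring
      rw [e, abs_mul, hs1, one_mul, abs_mul, abs_of_nonneg (by positivity)]
      calc 4 / 2 ^ (K + 1) * (1 - a) ^ 4
          ≤ 4 / 2 ^ (K + 1) * ((1 - a) ^ 2 * (1 - a ^ 2) ^ 4) := by gcongr
        _ = (1 - a) ^ 2 / 2 * (4 / 2 ^ K * (1 - a ^ 2) ^ 4) := by field_simp; ring
        _ ≤ _ := by gcongr
    · rcases hs 0 with h2 | h2 <;> rcases ht 0 with h3 | h3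
      · exact absurd (h2.trans h3.symm) h
      · exact (walshCorr_gap_of_ne_zero K hs ht h0 (by linarith) h2 h3).trans (le_abs_self _)
      · rw [abs_sub_comm]
        exact (walshCorr_gap_of_ne_zero K ht hs h0 (by linarith) h3 h2).trans (le_abs_self _)
      · exact absurd (h2.trans h3.symm) h

/-- The half-ratio autocorrelations of distinct Walsh characters are bounded away from each
other. -/
lemma autocorr_walsh_gap (K : ℕ) {s t : ℕ → ℝ} (hs : ∀ b, s b = 1 ∨ s b = -1)
    (ht : ∀ b, t b = 1 ∨ t b = -1) (hne : ∃ b < K, s b ≠ t b) :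
    1 / 16 ≤ |autocorr (1 / 2) (2 ^ K) (walsh K s) - autocorr (1 / 2) (2 ^ K) (walsh K t)| := by
  have h := walshCorr_gap K hs ht (a := 1 / 2) (by norm_num) le_rfl hne
  have es := two_mul_autocorr_walsh (r := 1 / 2) (by norm_num) K hs
  have et := two_mul_autocorr_walsh (r := 1 / 2) (by norm_num) K ht
  have e : autocorr (1 / 2) (2 ^ K) (walsh K s) - autocorr (1 / 2) (2 ^ K) (walsh K t) =
      2 ^ K / 4 * (walshCorr K s (1 / 2) - walshCorr K t (1 / 2)) := by linarith
  rw [e, abs_mul, abs_of_nonneg (by positivity)]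
  calc (1 / 16 : ℝ) = 2 ^ K / 4 * (4 / 2 ^ K * (1 - 1 / 2) ^ 4) := by field_simp; norm_num
    _ ≤ _ := by gcongr

/-! ### First symbol and run count of a random trace -/

instance (q : I) (n : ℕ) : IsProbabilityMeasure (deletionMeasure q n) := by
  unfold deletionMeasure; infer_instance

instance (q : I) (n k : ℕ) : IsProbabilityMeasure (tracesMeasure q n k) := by
  unfold tracesMeasure; infer_instance

lemma integral_deletionMeasure_succ (q : I) (n : ℕ) (f : (Fin (n + 1) → Bool) → ℝ) :
    ∫ ω, f ω ∂deletionMeasure q (n + 1) =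
      q * ∫ ω, f (Fin.cons true ω) ∂deletionMeasure q n +
        (1 - q) * ∫ ω, f (Fin.cons false ω) ∂deletionMeasure q n := by
  have h := (measurePreserving_piFinSuccAbove
    (fun _ : Fin (n + 1) => bernoulliMeasure true false q) 0).symm
  rw [deletionMeasure, ← h.integral_comp', integral_prod _ .of_finite,
    integral_bernoulliMeasure]
  simp [deletionMeasure, MeasurableEquiv.piFinSuccAbove, Fin.insertNthEquiv]

lemma trace_cons {n : ℕ} (y : ℕ → ZMod 2) (b : Bool) (ω : Fin n → Bool) :
    trace (fun i : Fin (n + 1) => y i) (Fin.cons b ω) =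
      if b then trace (fun i : Fin n => y (i + 1)) ω
      else y 0 :: trace (fun i : Fin n => y (i + 1)) ω := by
  cases b <;> simp [trace, List.finRange_succ, List.filter_map, Function.comp_def]

lemma numRuns_cons (a : ZMod 2) (l : List (ZMod 2)) :
    numRuns (a :: l) = numRuns l + if l.head? = some a then 0 else 1 := by
  cases l with
  | nil => simp [numRuns]
  | cons b l => simp [numRuns, eq_comm, add_comm]

lemma numRuns_le_length (l : List (ZMod 2)) : numRuns l ≤ l.length := by
  induction l with
  | nil => simp [numRuns]
  | cons a l ih => rw [numRuns_cons, List.length_cons]; split_ifs <;> omega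

lemma length_trace_le {n : ℕ} (x : Fin n → ZMod 2) (ω : Fin n → Bool) :
    (trace x ω).length ≤ n := by
  rw [trace, List.length_map]
  exact (List.length_filter_le _ _).trans (List.length_finRange).le

/-- The nontrivial character of `𝔽₂`. -/
def sgn (a : ZMod 2) : ℝ := if a = 0 then 1 else -1

lemma zmod_two_cases (a : ZMod 2) : a = 0 ∨ a = 1 := by
  revert a; decide

lemma sgn_zero : sgn 0 = 1 := by simp [sgn]

lemma sgn_one : sgn 1 = -1 := by simp [sgn]

lemma sgn_cases (a : ZMod 2) : sgn a = 1 ∨ sgn a = -1 := by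
  rcases zmod_two_cases a with rfl | rfl <;> simp [sgn]

lemma sgn_injective : Function.Injective sgn := by
  intro a b
  rcases zmod_two_cases a with rfl | rfl <;> rcases zmod_two_cases b with rfl | rfl <;>
    norm_num [sgn]

lemma sgn_add (a b : ZMod 2) : sgn (a + b) = sgn a * sgn b := by
  have h : (1 + 1 : ZMod 2) = 0 := by decide
  rcases zmod_two_cases a with rfl | rfl <;> rcases zmod_two_cases b with rfl | rfl <;>
    simp [sgn, h]

lemma indicator_eq_sgn (a b : ZMod 2) : (if b = a then 1 else 0 : ℝ) = (1 + sgn a * sgn b) / 2 := by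
  rcases zmod_two_cases a with rfl | rfl <;> rcases zmod_two_cases b with rfl | rfl <;>
    norm_num [sgn]

/-- Position j supplies the first symbol with probability 2^{-(j+1)}; the term 1 - 1/2^n is the
probability of a nonempty trace. -/
lemma integral_head_eq (a : ZMod 2) (n : ℕ) (y : ℕ → ZMod 2) :
    ∫ ω, (if (trace (fun i : Fin n => y i) ω).head? = some a then 1 else 0 : ℝ)
        ∂deletionMeasure half n =
      (1 - 1 / 2 ^ n) / 2 + sgn a * geomSum (1 / 2) n (fun j => sgn (y j)) / 4 := by
  induction n generalizing y with
  | zero => simp [trace, geomSum]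
  | succ n ih =>
    rw [integral_deletionMeasure_succ]
    simp only [trace_cons, if_true, Bool.false_eq_true, if_false, List.head?_cons,
      Option.some.injEq, ih fun j => y (j + 1), indicator_eq_sgn, geomSum]
    simp only [half, integral_const, probReal_univ, smul_eq_mul]
    rw [pow_succ]
    field_simp
    ring

/-- A kept first bit opens a new run unless the rest of the trace starts with the same symbol, so
`integral_head_eq` drives the induction. -/
lemma expectedRuns_half (n : ℕ) (y : ℕ → ZMod 2) :
    expectedRuns half (fun i : Fin n => y i) =
      (n + 2 - 2 / 2 ^ n) / 4 - autocorr (1 / 2) n (fun j => sgn (y j)) / 4 := by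
  induction n generalizing y with
  | zero => simp [expectedRuns, trace, autocorr, numRuns]
  | succ n ih =>
    have hsplit (ω : Fin n → Bool) :
        (numRuns (y 0 :: trace (fun i : Fin n => y (i + 1)) ω) : ℝ) =
          numRuns (trace (fun i : Fin n => y (i + 1)) ω) + (1 -
            if (trace (fun i : Fin n => y (i + 1)) ω).head? = some (y 0) then 1 else 0) := by
      rw [numRuns_cons]; split_ifs <;> simp
    have ih' := ih fun j => y (j + 1)
    rw [expectedRuns] at ih' ⊢
    rw [integral_deletionMeasure_succ]
    simp only [trace_cons, if_true, Bool.false_eq_true, if_false, hsplit]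
    rw [integral_add .of_finite .of_finite, integral_sub .of_finite .of_finite,
      integral_head_eq (y 0) n fun j => y (j + 1), ih']
    simp only [half, integral_const, probReal_univ, smul_eq_mul, autocorr]
    rw [pow_succ]
    push_cast
    field_simp
    ring

/-! ### Codewords as signed Walsh characters -/

/-- The sum factors as ∏ (1 + s_b r^{2^b}), and (1 - r)² is preserved by the recursion since (1 +
r)(1 - r²) ≥ 1 for r ≤ 1/2. -/
lemma geomSum_walsh_ge (K : ℕ) {s : ℕ → ℝ} (hs : ∀ b, s b = 1 ∨ s b = -1) {r : ℝ}
    (h0 : 0 < r) (h1 : r ≤ 1 / 2) : (1 - r) ^ 2 ≤ geomSum r (2 ^ K) (walsh K s) := by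
  induction K generalizing s r with
  | zero =>
    simp only [geomSum, walsh, Finset.range_zero, Finset.prod_empty, pow_zero]
    nlinarith
  | succ K ih =>
    have h := ih (fun b => hs (b + 1)) (by positivity : 0 < r ^ 2) (by nlinarith)
    have hc : 1 - r ≤ 1 + s 0 * r := by
      rcases hs 0 with h | h <;> rw [h] <;> linarith
    have h2 : 1 ≤ (1 + r) * (1 - r ^ 2) := by nlinarith
    rw [walsh_succ, pow_succ' 2 K, geomSum_double]
    calc (1 - r) ^ 2 ≤ (1 - r) ^ 2 * ((1 + r) * (1 - r ^ 2)) :=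
          le_mul_of_one_le_right (sq_nonneg _) h2
      _ = (1 - r) * (1 - r ^ 2) ^ 2 := by ring
      _ ≤ _ := mul_le_mul hc h (sq_nonneg _) (by linarith)

/-- The value of the affine function `u₀ + ∑ i, u i * x i` at the `j`-th point. -/
def affineSeq (m : ℕ) (u₀ : ZMod 2) (u : Fin m → ZMod 2) (j : ℕ) : ZMod 2 :=
  u₀ + ∑ i : Fin m, if j.testBit (m - 1 - i) then u i else 0

lemma evalVec_affinePoly (m : ℕ) (u₀ : ZMod 2) (u : Fin m → ZMod 2) :
    evalVec m (affinePoly m u₀ u) = fun j : Fin (2 ^ m) => affineSeq m u₀ u j := by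
  funext j
  simp [evalVec, affinePoly, affineSeq, lexPoint]

/-- The signs of the linear part of an affine function, indexed by binary digits. -/
def digitSigns {m : ℕ} (u : Fin m → ZMod 2) (b : ℕ) : ℝ :=
  if h : b < m then sgn (u (Fin.rev ⟨b, h⟩)) else 1

lemma digitSigns_cases {m : ℕ} (u : Fin m → ZMod 2) (b : ℕ) :
    digitSigns u b = 1 ∨ digitSigns u b = -1 := by
  unfold digitSigns
  split_ifs
  · exact sgn_cases _
  · exact .inl rfl

lemma sgn_sum {ι : Type*} (s : Finset ι) (f : ι → ZMod 2) :
    sgn (∑ i ∈ s, f i) = ∏ i ∈ s, sgn (f i) := by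
  classical
  induction s using Finset.induction_on with
  | empty => simp [sgn]
  | insert a s ha ih => rw [Finset.sum_insert ha, Finset.prod_insert ha, sgn_add, ih]

lemma sgn_affineSeq (m : ℕ) (u₀ : ZMod 2) (u : Fin m → ZMod 2) :
    (fun j => sgn (affineSeq m u₀ u j)) = fun j => sgn u₀ * walsh m (digitSigns u) j := by
  funext j
  rw [affineSeq, sgn_add, sgn_sum, walsh, Finset.prod_range, ← Equiv.prod_comp Fin.revPerm]
  congr 1
  refine Finset.prod_congr rfl fun i _ => ?_
  -- Coordinates are listed most significant digit first, hence the reversal.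
  have h : m - 1 - (m - (i + 1)) = (i : ℕ) := by omega
  simp [digitSigns, apply_ite sgn, sgn_zero, h]

lemma affineSeq_zero (m : ℕ) (u₀ : ZMod 2) (u : Fin m → ZMod 2) : affineSeq m u₀ u 0 = u₀ := by
  simp [affineSeq]

lemma expectedRuns_gap {m : ℕ} {x z : Fin (2 ^ m) → ZMod 2} (hx : x ∈ RM1 m) (hz : z ∈ RM1 m)
    (h0 : x ⟨0, Nat.two_pow_pos m⟩ = z ⟨0, Nat.two_pow_pos m⟩) (hne : x ≠ z) :
    1 / 64 ≤ |expectedRuns half x - expectedRuns half z| := by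
  obtain ⟨u₀, u, rfl⟩ := hx
  obtain ⟨v₀, v, rfl⟩ := hz
  simp only [evalVec_affinePoly, affineSeq_zero] at h0 hne ⊢
  subst h0
  have huv : u ≠ v := fun h => hne (by rw [h])
  obtain ⟨i, hi⟩ := Function.ne_iff.1 huv
  have hs : sgn u₀ ^ 2 = 1 := sq_eq_one_of_sign (sgn_cases u₀)
  have h := autocorr_walsh_gap m (digitSigns_cases u) (digitSigns_cases v)
    ⟨Fin.rev i, (Fin.rev i).2, by
      simpa only [digitSigns, Fin.is_lt, dite_true, Fin.eta, Fin.rev_rev] using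
        fun h => hi (sgn_injective h)⟩
  rw [expectedRuns_half, expectedRuns_half, sgn_affineSeq, sgn_affineSeq,
    autocorr_smul _ _ hs, autocorr_smul _ _ hs, sub_sub_sub_cancel_left, ← sub_div, abs_div,
    abs_sub_comm]
  norm_num at h ⊢
  linarith

/-- The generating sum is at least 1/4, a bias of 1/16; empty traces cost at most 1/32 because n ≥
4. For n = 2 and x = (1, 0) the probability is exactly 1/2. -/
lemma integral_head_codeword {m : ℕ} (hm : 2 ≤ m) {x : Fin (2 ^ m) → ZMod 2} (hx : x ∈ RM1 m) :
    (x ⟨0, Nat.two_pow_pos m⟩ = 1 → 1 / 2 + 1 / 32 ≤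
      ∫ ω, (if (trace x ω).head? = some 1 then 1 else 0 : ℝ) ∂deletionMeasure half (2 ^ m)) ∧
    (x ⟨0, Nat.two_pow_pos m⟩ = 0 →
      ∫ ω, (if (trace x ω).head? = some 1 then 1 else 0 : ℝ) ∂deletionMeasure half (2 ^ m) ≤
        1 / 2 - 1 / 32) := by
  obtain ⟨u₀, u, rfl⟩ := hx
  have hG := geomSum_walsh_ge m (digitSigns_cases u) (r := 1 / 2) (by norm_num) le_rfl
  have hN : (1 : ℝ) / 2 ^ 2 ^ m ≤ 1 / 16 := by
    have h4 : 2 ^ 2 ≤ 2 ^ m := Nat.pow_le_pow_right (by norm_num) hm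
    have := pow_le_pow_right₀ (by norm_num : (1 : ℝ) ≤ 2) h4
    exact one_div_le_one_div_of_le (by norm_num) (by norm_num at this ⊢; exact this)
  have hN0 : (0 : ℝ) < 1 / 2 ^ 2 ^ m := by positivity
  simp only [evalVec_affinePoly, affineSeq_zero, integral_head_eq, sgn_affineSeq, geomSum_smul,
    sgn_one]
  constructor <;> rintro rfl <;> simp only [sgn_one, sgn_zero] <;> linarith

/-! ### Concentration of the two statistics -/

/-- Hoeffding's inequality for a bounded statistic of independent traces. -/
lemma hoeffding_traces (q : I) (n k : ℕ) (f : (Fin n → Bool) → ℝ) {a b t : ℝ} (hab : a < b)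
    (hf : ∀ ω, f ω ∈ Set.Icc a b) (s : Finset (Fin k)) (hs : s.Nonempty) (ht : 0 ≤ t) :
    (tracesMeasure q n k).real
        {ω | s.card * t ≤ ∑ i ∈ s, (f (ω i) - ∫ η, f η ∂deletionMeasure q n)} ≤
      Real.exp (-(2 * s.card * t ^ 2 / (b - a) ^ 2)) := by
  set E := ∫ η, f η ∂deletionMeasure q n
  have hind : iIndepFun (fun (i : Fin k) (ω : Fin k → Fin n → Bool) => f (ω i) - E)
      (tracesMeasure q n k) :=
    iIndepFun_pi (X := fun _ ω => f ω - E) fun _ => (measurable_of_finite _).aemeasurable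
  have hE (i : Fin k) : ∫ ω, f (ω i) ∂tracesMeasure q n k = E :=
    integral_comp_eval (measurable_of_finite f).aestronglyMeasurable
  have hsub (i : Fin k) : HasSubgaussianMGF
      (fun ω : Fin k → Fin n → Bool => f (ω i) - E) ((‖b - a‖₊ / 2) ^ 2)
      (tracesMeasure q n k) := by
    rw [← hE i]
    exact hasSubgaussianMGF_of_mem_Icc (measurable_of_finite _).aemeasurable
      (.of_forall fun ω => hf (ω i))
  have hcard : (0 : ℝ) < s.card := by exact_mod_cast hs.card_pos
  refine (HasSubgaussianMGF.measure_sum_ge_le_of_iIndepFun hind (fun i _ => hsub i)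
    (mul_nonneg hcard.le ht)).trans (Real.exp_le_exp.2 (le_of_eq ?_))
  have hba : 0 < b - a := sub_pos.2 hab
  simp only [Finset.sum_const, nsmul_eq_mul, NNReal.coe_pow, NNReal.coe_div, coe_nnnorm,
    NNReal.coe_mul, NNReal.coe_natCast, NNReal.coe_ofNat, Real.norm_of_nonneg hba.le]
  field_simp

lemma exp_neg_le_inv_pow {n A : ℝ} (hn : 0 < n) (c : ℕ) (hA : (c + 1) * Real.log n ≤ A) :
    Real.exp (-A) ≤ 1 / n ^ (c + 1) := by
  rw [one_div, Real.exp_neg]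
  refine inv_anti₀ (by positivity) ?_
  rw [← Real.exp_log (pow_pos hn (c + 1)), Real.log_pow]
  exact Real.exp_le_exp.2 (by push_cast; exact hA)

lemma sum_indicator_head {n k : ℕ} (ℓ : ℕ) (x : Fin n → ZMod 2) (ω : Fin k → Fin n → Bool) :
    ((Finset.univ.filter fun i : Fin k =>
        (i : ℕ) < ℓ ∧ (trace x (ω i)).head? = some 1).card : ℝ) =
      ∑ i ∈ Finset.univ.filter fun i : Fin k => (i : ℕ) < ℓ,
        (if (trace x (ω i)).head? = some 1 then 1 else 0 : ℝ) := by
  rw [Finset.sum_boole, Finset.filter_filter]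

lemma card_filter_lt {k ℓ : ℕ} (h : ℓ ≤ k) :
    (Finset.univ.filter fun i : Fin k => (i : ℕ) < ℓ).card = ℓ := by
  rw [Fin.card_filter_val_lt, min_eq_right h]

/-- The majority vote fails with exponentially small probability. -/
lemma majorityBit_error {m : ℕ} (hm : 2 ≤ m) {x : Fin (2 ^ m) → ZMod 2} (hx : x ∈ RM1 m)
    {ℓ k : ℕ} (hℓ : 0 < ℓ) (hk : ℓ ≤ k) :
    (tracesMeasure half (2 ^ m) k).real
        {ω | majorityBit ℓ (fun i => trace x (ω i)) ≠ x ⟨0, Nat.two_pow_pos m⟩} ≤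
      Real.exp (-(ℓ / 512)) := by
  set f : (Fin (2 ^ m) → Bool) → ℝ := fun ω => if (trace x ω).head? = some 1 then 1 else 0
  set s := Finset.univ.filter fun i : Fin k => (i : ℕ) < ℓ
  have hcard : s.card = ℓ := card_filter_lt hk
  have hs : s.Nonempty := Finset.card_pos.1 (by omega)
  obtain ⟨h1, h0⟩ := integral_head_codeword hm hx
  have hexp : (-(2 * (s.card : ℝ) * (1 / 32) ^ 2 / (1 - 0) ^ 2)) = -(ℓ / 512) := by
    rw [hcard]; ring
  rcases zmod_two_cases (x ⟨0, Nat.two_pow_pos m⟩) with hb | hb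
  · have hE := h0 hb
    have hoeff := hoeffding_traces half (2 ^ m) k f (a := 0) (b := 1) (t := 1 / 32)
      one_pos (fun ω => by simp only [f]; split_ifs <;> simp) s hs (by norm_num)
    rw [hexp] at hoeff
    refine (measureReal_mono fun ω hω => ?_).trans hoeff
    simp only [Set.mem_ofPred_eq, hb, majorityBit, sum_indicator_head] at hω ⊢
    rw [Finset.sum_sub_distrib, Finset.sum_const, nsmul_eq_mul, hcard]
    by_contra hlt
    apply hω
    rw [if_neg]
    have := mul_le_mul_of_nonneg_left hE (Nat.cast_nonneg (α := ℝ) ℓ)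
    simp only [f, s] at hlt this ⊢
    linarith
  · have hE := h1 hb
    -- The lower tail of the vote is the upper tail for the negated indicator.
    have hoeff := hoeffding_traces half (2 ^ m) k (fun ω => -f ω) (a := -1) (b := 0)
      (t := 1 / 32) (by norm_num) (fun ω => by simp only [f]; split_ifs <;> simp) s hs
      (by norm_num)
    rw [show (0 - -1 : ℝ) = 1 - 0 by norm_num, hexp] at hoeff
    refine (measureReal_mono fun ω hω => ?_).trans hoeff
    simp only [Set.mem_ofPred_eq, hb, majorityBit, sum_indicator_head] at hω ⊢
    rw [Finset.sum_sub_distrib, Finset.sum_const, nsmul_eq_mul, hcard, integral_neg,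
      Finset.sum_neg_distrib]
    by_contra hlt
    apply hω
    rw [if_pos]
    have := mul_le_mul_of_nonneg_left hE (Nat.cast_nonneg (α := ℝ) ℓ)
    simp only [f, s] at hlt this ⊢
    linarith

/-- The empirical average of the number of runs concentrates around its expectation. -/
lemma averageRuns_error {n k : ℕ} (hn : 0 < n) (hk : 0 < k) (q : I) (x : Fin n → ZMod 2)
    {t : ℝ} (ht : 0 ≤ t) :
    (tracesMeasure q n k).real
        {ω | t ≤ |expectedRuns q x - averageRuns (fun i => trace x (ω i))|} ≤
      2 * Real.exp (-(2 * k * t ^ 2 / n ^ 2)) := by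
  have hk' : (0 : ℝ) < k := by exact_mod_cast hk
  have hn' : (0 : ℝ) < n := by exact_mod_cast hn
  have hne : (Finset.univ : Finset (Fin k)).Nonempty := Finset.card_pos.1 (by simpa using hk)
  have hle (ω : Fin n → Bool) : (numRuns (trace x ω) : ℝ) ≤ n := by
    exact_mod_cast (numRuns_le_length _).trans (length_trace_le x ω)
  have hup := hoeffding_traces q n k (fun ω => (numRuns (trace x ω) : ℝ)) hn'
    (fun ω => ⟨Nat.cast_nonneg _, hle ω⟩) Finset.univ hne ht
  have hlo := hoeffding_traces q n k (fun ω => -(numRuns (trace x ω) : ℝ)) (neg_lt_zero.2 hn')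
    (fun ω => ⟨neg_le_neg (hle ω), neg_nonpos.2 (Nat.cast_nonneg _)⟩) Finset.univ hne ht
  rw [sub_zero] at hup
  rw [zero_sub, neg_neg] at hlo
  simp only [Finset.card_univ, Fintype.card_fin] at hup hlo
  rw [two_mul]
  refine (measureReal_mono fun ω hω => ?_).trans
    ((measureReal_union_le _ _).trans (add_le_add hup hlo))
  have hav : ∑ i, (numRuns (trace x (ω i)) : ℝ) = k * averageRuns (fun i => trace x (ω i)) := by
    rw [averageRuns]; field_simp
  simp only [Set.mem_ofPred_eq, Set.mem_union, Finset.sum_sub_distrib, Finset.sum_const,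
    Finset.card_univ, Fintype.card_fin, nsmul_eq_mul, integral_neg, Finset.sum_neg_distrib,
    hav] at hω ⊢
  change _ ≤ |(∫ η, (numRuns (trace x η) : ℝ) ∂deletionMeasure q n) - _| at hω
  rcases le_abs.1 hω with h | h
  · right
    linarith [mul_le_mul_of_nonneg_left h hk'.le]
  · left
    linarith [mul_le_mul_of_nonneg_left h hk'.le]

/-! ### Correctness of the algorithm -/

/-- If the vote is right and the average number of runs is close to its expectation, then the
algorithm outputs the transmitted codeword and nothing else. -/
lemma isOutput_iff {m k ℓ : ℕ} {x : Fin (2 ^ m) → ZMod 2} (hx : x ∈ RM1 m)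
    {T : Fin k → List (ZMod 2)} (hb : majorityBit ℓ T = x ⟨0, Nat.two_pow_pos m⟩)
    (hR : |expectedRuns half x - averageRuns T| < 1 / 128) (z : Fin (2 ^ m) → ZMod 2) :
    IsOutput m ℓ T z ↔ z = x := by
  have hxc : x ∈ candidates m ℓ T := ⟨hx, hb.symm⟩
  have hfar (y) (hy : y ∈ candidates m ℓ T) (hne : y ≠ x) :
      |expectedRuns half x - averageRuns T| < |expectedRuns half y - averageRuns T| := by
    have h := expectedRuns_gap hx hy.1 (hb.symm.trans hy.2.symm) hne.symm
    have h2 := abs_sub_le (expectedRuns half x) (averageRuns T) (expectedRuns half y)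
    rw [abs_sub_comm (averageRuns T)] at h2
    linarith
  constructor
  · intro hz
    by_contra hne
    exact absurd (hz.2 x hxc) (not_le.2 (hfar z hz.1 hne))
  · rintro rfl
    refine ⟨hxc, fun y hy => ?_⟩
    by_cases h : y = z
    · rw [h]
    · exact (hfar y hy h).le

lemma one_le_log_two_pow {m : ℕ} (hm : 2 ≤ m) : 1 ≤ Real.log ((2 : ℝ) ^ m) := by
  have h2 := Real.log_two_gt_d9
  have : (2 : ℝ) ≤ m := by exact_mod_cast hm
  rw [Real.log_pow]
  nlinarith

lemma four_le_two_pow {m : ℕ} (hm : 2 ≤ m) : (4 : ℝ) ≤ 2 ^ m := by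
  calc (4 : ℝ) = 2 ^ 2 := by norm_num
    _ ≤ 2 ^ m := pow_le_pow_right₀ (by norm_num) hm

lemma run_counting_succeeds (c : ℕ) {m : ℕ} (hm : 2 ≤ m) {ℓ k : ℕ}
    (hℓ : 512 * (c + 1) * Real.log ((2 : ℝ) ^ m) ≤ ℓ)
    (hk : 32768 * (c + 1) * ((2 : ℝ) ^ m) ^ 2 * Real.log ((2 : ℝ) ^ m) ≤ k) (hℓk : ℓ ≤ k)
    {x : Fin (2 ^ m) → ZMod 2} (hx : x ∈ RM1 m) :
    1 - 1 / ((2 : ℝ) ^ m) ^ c ≤ (tracesMeasure half (2 ^ m) k).real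
      {ω | ∀ z, IsOutput m ℓ (fun i => trace x (ω i)) z ↔ z = x} := by
  have hL := one_le_log_two_pow hm
  have hn4 := four_le_two_pow hm
  have hn : (0 : ℝ) < 2 ^ m := by positivity
  have hℓ0 : 0 < ℓ := by
    have : (0 : ℝ) < ℓ := lt_of_lt_of_le (by positivity) hℓ
    exact_mod_cast this
  have h1 := (majorityBit_error hm hx hℓ0 hℓk).trans
    (exp_neg_le_inv_pow hn c (by rw [le_div_iff₀ (by norm_num)]; linarith))
  -- With t = 1/256, below half the gap 1/64, the exponent is k/(32768 n²). The failures total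
  -- 3/n^{c+1}, at most 1/n^c as n ≥ 4.
  have h2 := (averageRuns_error (Nat.two_pow_pos m) (hℓ0.trans_le hℓk) half x
    (t := 1 / 256) (by norm_num)).trans
    (mul_le_mul_of_nonneg_left (exp_neg_le_inv_pow hn c (by
      push_cast
      rw [le_div_iff₀ (by positivity)]; linarith)) two_pos.le)
  set B₁ := {ω : Fin k → Fin (2 ^ m) → Bool |
    majorityBit ℓ (fun i => trace x (ω i)) ≠ x ⟨0, Nat.two_pow_pos m⟩}
  set B₂ := {ω : Fin k → Fin (2 ^ m) → Bool |
    1 / 256 ≤ |expectedRuns half x - averageRuns (fun i => trace x (ω i))|}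
  have hsub : (B₁ ∪ B₂)ᶜ ⊆ {ω | ∀ z, IsOutput m ℓ (fun i => trace x (ω i)) z ↔ z = x} := by
    intro ω hω
    rw [Set.mem_compl_iff, Set.mem_union, not_or] at hω
    exact isOutput_iff hx (not_not.1 hω.1) ((not_le.1 hω.2).trans (by norm_num))
  have hcompl := probReal_compl_eq_one_sub (μ := tracesMeasure half (2 ^ m) k)
    (Set.toFinite (B₁ ∪ B₂)).measurableSet
  have hunion := measureReal_union_le (μ := tracesMeasure half (2 ^ m) k) B₁ B₂
  have hmono := measureReal_mono (μ := tracesMeasure half (2 ^ m) k) hsub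
  have hfin : 3 * (1 / ((2 : ℝ) ^ m) ^ (c + 1)) ≤ 1 / ((2 : ℝ) ^ m) ^ c := by
    rw [pow_succ]
    field_simp
    linarith
  linarith

/-! ### Reconstruction from an undeleted trace -/

/-- Read the sequence off a trace in which no bit is deleted, if there is one. -/
def readFullTrace (n : ℕ) {k : ℕ} (T : Fin k → List (ZMod 2)) (j : Fin n) : ZMod 2 :=
  open Classical in if h : ∃ i, (T i).length = n then (T h.choose).getD j 0 else 0

lemma trace_eq_ofFn {n : ℕ} {x : Fin n → ZMod 2} {ω : Fin n → Bool}
    (h : (trace x ω).length = n) : trace x ω = List.ofFn x := by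
  rw [trace, List.length_map] at h
  have h2 : ((List.finRange n).filter fun j => !ω j).length = (List.finRange n).length := by
    rw [h, List.length_finRange]
  rw [trace, List.filter_sublist.eq_of_length h2, List.ofFn_eq_map]

lemma readFullTrace_eq {n k : ℕ} {x : Fin n → ZMod 2} {ω : Fin k → Fin n → Bool}
    (h : ∃ i, ω i = fun _ => false) : readFullTrace n (fun i => trace x (ω i)) = x := by
  obtain ⟨i, hi⟩ := h
  have hex : ∃ i, (trace x (ω i)).length = n := ⟨i, by simp [hi, trace]⟩
  funext j
  simp only [readFullTrace]
  rw [dif_pos hex, trace_eq_ofFn hex.choose_spec]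
  simp

lemma readFullTrace_succeeds (n k : ℕ) (x : Fin n → ZMod 2) :
    1 - (1 - (1 / 2 : ℝ) ^ n) ^ k ≤ (tracesMeasure half n k).real
      {ω | readFullTrace n (fun i => trace x (ω i)) = x} := by
  have h1 : (deletionMeasure half n).real {fun _ => false} = (1 / 2) ^ n := by
    rw [measureReal_def, deletionMeasure, Measure.pi_singleton, ENNReal.toReal_prod]
    simp only [← measureReal_def]
    rw [Finset.prod_congr rfl fun i _ =>
      bernoulliMeasure_real_apply_of_notMem_of_mem half (measurableSet_singleton _)
        (by simp) (by simp)]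
    norm_num [half, one_div_pow]
  have h2 : (tracesMeasure half n k).real (Set.univ.pi fun _ => {fun _ => false}ᶜ) =
      (1 - (1 / 2) ^ n) ^ k := by
    rw [measureReal_def, tracesMeasure, Measure.pi_pi, ENNReal.toReal_prod]
    simp only [← measureReal_def]
    rw [probReal_compl_eq_one_sub (measurableSet_singleton _), h1]
    simp
  rw [← h2, ← probReal_compl_eq_one_sub (Set.toFinite _).measurableSet]
  refine measureReal_mono fun ω hω => readFullTrace_eq ?_
  simpa using hω

end TraceRM

end

theorem theorem2 (c : ℕ) :
    (∃ C : ℝ, 0 < C ∧ ∀ m : ℕ, 1 ≤ m →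
      ∃ k : ℕ, (k : ℝ) ≤ C * ((2 : ℝ) ^ m) ^ 2 * Real.log ((2 : ℝ) ^ m) ∧
      ∃ recon : (Fin k → List (ZMod 2)) → (Fin (2 ^ m) → ZMod 2),
        ∀ x ∈ TraceRM.RM1 m,
          1 - 1 / ((2 : ℝ) ^ m) ^ c ≤
            (TraceRM.tracesMeasure TraceRM.half (2 ^ m) k).real
              {ω | recon (fun i => TraceRM.trace x (ω i)) = x}) ∧
    (∃ c₁ c₂ : ℝ, 0 < c₁ ∧ 0 < c₂ ∧ ∀ m : ℕ, 2 ≤ m → ∀ ℓ k : ℕ,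
      ℓ = ⌈c₁ * Real.log ((2 : ℝ) ^ m)⌉₊ →
      k = ⌈c₂ * ((2 : ℝ) ^ m) ^ 2 * Real.log ((2 : ℝ) ^ m)⌉₊ →
        ℓ < k ∧
        ∀ x ∈ TraceRM.RM1 m,
          1 - 1 / ((2 : ℝ) ^ m) ^ c ≤
            (TraceRM.tracesMeasure TraceRM.half (2 ^ m) k).real
              {ω | ∀ z, TraceRM.IsOutput m ℓ (fun i => TraceRM.trace x (ω i)) z ↔ z = x}) := by
  have hc : (0 : ℝ) ≤ c := Nat.cast_nonneg c
  have second : ∀ m : ℕ, 2 ≤ m → ∀ ℓ k : ℕ,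
      ℓ = ⌈512 * (c + 1 : ℝ) * Real.log ((2 : ℝ) ^ m)⌉₊ →
      k = ⌈32768 * (c + 1 : ℝ) * ((2 : ℝ) ^ m) ^ 2 * Real.log ((2 : ℝ) ^ m)⌉₊ →
        ℓ < k ∧ ∀ x ∈ TraceRM.RM1 m, 1 - 1 / ((2 : ℝ) ^ m) ^ c ≤
          (TraceRM.tracesMeasure TraceRM.half (2 ^ m) k).real
            {ω | ∀ z, TraceRM.IsOutput m ℓ (fun i => TraceRM.trace x (ω i)) z ↔ z = x} := by
    intro m hm ℓ k hℓ hk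
    have hL := TraceRM.one_le_log_two_pow hm
    have hn := TraceRM.four_le_two_pow hm
    have hℓ1 := hℓ ▸ Nat.le_ceil (512 * (c + 1 : ℝ) * Real.log ((2 : ℝ) ^ m))
    have hℓ2 := hℓ ▸ Nat.ceil_lt_add_one
      (by positivity : 0 ≤ 512 * (c + 1 : ℝ) * Real.log ((2 : ℝ) ^ m))
    have hk1 := hk ▸ Nat.le_ceil
      (32768 * (c + 1 : ℝ) * ((2 : ℝ) ^ m) ^ 2 * Real.log ((2 : ℝ) ^ m))
    have hlt : ℓ < k := by
      have hcL : 1 ≤ (c + 1 : ℝ) * Real.log ((2 : ℝ) ^ m) := by nlinarith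
      have hn2 : 1 ≤ ((2 : ℝ) ^ m) ^ 2 := by nlinarith
      have := mul_le_mul_of_nonneg_left hn2 (zero_le_one.trans hcL)
      have h : (ℓ : ℝ) < k := by linarith
      exact_mod_cast h
    exact ⟨hlt, fun x hx => TraceRM.run_counting_succeeds c hm hℓ1 hk1 hlt.le hx⟩
  refine ⟨⟨32768 * (c + 1) + 1, by positivity, fun m hm => ?_⟩,
    512 * (c + 1), 32768 * (c + 1), by positivity, by positivity, second⟩
  obtain rfl | hm : m = 1 ∨ 2 ≤ m := by omega
  -- Here n = 2, and all 3c traces lose a bit with probability (3/4)^{3c} = (27/64)^c ≤ 2^{-c}.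
  · refine ⟨3 * c, ?_, TraceRM.readFullTrace _, fun x _ => ?_⟩
    · have := Real.log_two_gt_d9
      push_cast
      rw [pow_one]
      nlinarith
    · refine le_trans ?_ (TraceRM.readFullTrace_succeeds _ _ x)
      have h : ((27 / 64 : ℝ)) ^ c ≤ (1 / 2) ^ c :=
        pow_le_pow_left₀ (by norm_num) (by norm_num) c
      rw [pow_mul, pow_one, ← one_div_pow]
      norm_num at h ⊢
      linarith
  · have hL := TraceRM.one_le_log_two_pow hm
    have hn := TraceRM.four_le_two_pow hm
    -- Any choice of output works, since on the good event it is unique. The extra 1 in the constant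
    -- absorbs the ceiling.
    refine ⟨_, ?_, fun T => Classical.epsilon (TraceRM.IsOutput m
      ⌈512 * (c + 1 : ℝ) * Real.log ((2 : ℝ) ^ m)⌉₊ T), fun x hx =>
      ((second m hm _ _ rfl rfl).2 x hx).trans (measureReal_mono fun ω hω => ?_)⟩
    · have := Nat.ceil_lt_add_one
        (by positivity : 0 ≤ 32768 * (c + 1 : ℝ) * ((2 : ℝ) ^ m) ^ 2 * Real.log ((2 : ℝ) ^ m))
      have h1 : 1 ≤ ((2 : ℝ) ^ m) ^ 2 * Real.log ((2 : ℝ) ^ m) := by nlinarith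
      linarith
    · exact (hω _).1 (Classical.epsilon_spec ⟨x, (hω x).2 rfl⟩)
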